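/- Let $k,s\ge 1$ be integers. A symmetric gauge function on $\mathbb R^d$ is a norm $\tau$ on $\mathbb R^d$ that is invariant under permutations and sign changes of the coordinates. For $A\in\mathbb R^{k\times s}$ let $\sigma(A)\in\mathbb R^{k\wedge s}$ be the vector of singular values of $A$ in decreasing order, and for a symmetric gauge function $\tau$ on $\mathbb R^{k\wedge s}$ put $\|A\|_\tau=\tau(\sigma(A))$. Every norm on $\mathbb R^{k\times s}$ that is unitarily invariant, i.e. satisfies $\|UAV\|=\|A\|$ for all orthogonal $U\in O(k)$, $V\in O(s)$, is of the form $\|\cdot\|_\tau$ for some symmetric gauge function $\tau$ on $\mathbb R^{k\wedge s}$. One observes $Y=M+Z$, where $M\in\mathbb R^{k\times s}$ is unknown and arbitrary and $Z$ has i.i.d. $N(0,1)$ entries. There are absolute constants $0<c\le C<\infty$ (independent of $k$, $s$ and $\tau$) such that for all $k,s\ge 1$ and every symmetric gauge function $\tau$ on $\mathbb R^{k\wedge s}$, $$c\,(k\vee s)\,\tau^2(\mathbf 1)\;\le\;\inf_{\widetilde M}\ \sup_{M\in\mathbb R^{k\times s}}\mathbb E\,\|\widetilde M(Y)-M\|_\tau^2\;\le\;C\,(k\vee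 s)\,\tau^2(\mathbf 1),$$ where the infimum is over all estimators, i.e. measurable maps $\widetilde M:\mathbb R^{k\times s}\to\mathbb R^{k\times s}$, and $\mathbf 1$ is the all-ones vector of $\mathbb R^{k\wedge s}$. Moreover the observation itself attains the rate: $\sup_{M}\mathbb E\,\|Y-M\|_\tau^2\le C\,(k\vee s)\,\tau^2(\mathbf 1)$. -/

import Mathlib

open MeasureTheory ProbabilityTheory
open scoped ENNReal

namespace MatrixMinimax

/-- `N` is a norm on the real vector space `V`. -/
structure IsNorm {V : Type*} [AddCommGroup V] [Module ℝ V] (N : V → ℝ) : Prop where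
  nonneg : ∀ x, 0 ≤ N x
  eq_zero_iff : ∀ x, N x = 0 ↔ x = 0
  smul : ∀ (a : ℝ) (x : V), N (a • x) = |a| * N x
  add_le : ∀ x y, N (x + y) ≤ N x + N y

/-- A symmetric gauge function on `ℝ^d`: a norm invariant under permutations of the coordinates and
under changes of their signs. -/
structure IsSymmetricGauge {d : ℕ} (τ : (Fin d → ℝ) → ℝ) : Prop extends IsNorm τ where
  invariant : ∀ (π : Equiv.Perm (Fin d)) (ε : Fin d → ℝ), (∀ i, ε i = 1 ∨ ε i = -1) →
    ∀ x : Fin d → ℝ, τ (fun i => ε i * x (π i)) = τ x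

/-- A norm on `ℝ^{k×s}` with `N (U A V) = N A` for all orthogonal `U ∈ O(k)`, `V ∈ O(s)`. -/
structure IsUnitarilyInvariantNorm {k s : ℕ} (N : Matrix (Fin k) (Fin s) ℝ → ℝ) : Prop
    extends IsNorm N where
  invariant : ∀ U ∈ Matrix.orthogonalGroup (Fin k) ℝ, ∀ V ∈ Matrix.orthogonalGroup (Fin s) ℝ,
    ∀ A : Matrix (Fin k) (Fin s) ℝ, N (U * A * V) = N A

/-- The vector `σ(A) ∈ ℝ^{k ∧ s}` of singular values of `A ∈ ℝ^{k×s}`, in decreasing order. -/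
noncomputable def singularVector {k s : ℕ} (A : Matrix (Fin k) (Fin s) ℝ) : Fin (min k s) → ℝ :=
  fun i => (Matrix.toEuclideanLin A).singularValues i

/-- `‖A‖_τ = τ(σ(A))`. -/
noncomputable def gaugeNorm {k s : ℕ} (τ : (Fin (min k s) → ℝ) → ℝ)
    (A : Matrix (Fin k) (Fin s) ℝ) : ℝ :=
  τ (singularVector A)

/-- The Borel (product) σ-algebra on `ℝ^{k×s}`. -/
instance instMeasurableSpaceMatrix (k s : ℕ) : MeasurableSpace (Matrix (Fin k) (Fin s) ℝ) :=
  inferInstanceAs (MeasurableSpace (Fin k → Fin s → ℝ))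

theorem measurable_matrix_of (k s : ℕ) :
    Measurable (Matrix.of : (Fin k → Fin s → ℝ) → Matrix (Fin k) (Fin s) ℝ) :=
  measurable_id

theorem measurable_matrix_of_symm (k s : ℕ) :
    Measurable (Matrix.of.symm : Matrix (Fin k) (Fin s) ℝ → (Fin k → Fin s → ℝ)) :=
  measurable_id

/-- The law of a `k × s` matrix `Z` with i.i.d. standard normal entries. -/
noncomputable def gaussianNoise (k s : ℕ) : Measure (Matrix (Fin k) (Fin s) ℝ) :=
  (Measure.pi fun _ : Fin k => Measure.pi fun _ : Fin s => gaussianReal 0 1).map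
    (Matrix.of : (Fin k → Fin s → ℝ) → Matrix (Fin k) (Fin s) ℝ)

/-- The worst-case risk `sup_M E (N (est (Y) - M))^2`, where `Y = M + Z`, of the estimator `est`
under the squared loss of `N`. -/
noncomputable def maxRisk {k s : ℕ} (N : Matrix (Fin k) (Fin s) ℝ → ℝ)
    (est : Matrix (Fin k) (Fin s) ℝ → Matrix (Fin k) (Fin s) ℝ) : ℝ≥0∞ :=
  ⨆ M : Matrix (Fin k) (Fin s) ℝ,
    ∫⁻ Z, ENNReal.ofReal (N (est (M + Z) - M) ^ 2) ∂(gaussianNoise k s)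

/-- The minimax risk: the infimum of the worst-case risk over all measurable functions of `Y`. -/
noncomputable def minimaxRisk {k s : ℕ} (N : Matrix (Fin k) (Fin s) ℝ → ℝ) : ℝ≥0∞ :=
  ⨅ (est : Matrix (Fin k) (Fin s) ℝ → Matrix (Fin k) (Fin s) ℝ) (_ : Measurable est),
    maxRisk N est

end MatrixMinimax

/-! Write `d = min k s`, so that `k * s = d * max k s`. Everything rests on comparing `‖·‖_τ` with
the operator and nuclear norms, together with a second moment of order `k + s` for the operator norm
of the noise.

Upper bound: the error of the observation is `Z` itself, and `‖Z‖_τ ≤ ‖Z‖_op τ(1)` because a gauge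
on a cube is largest at the vertices (`IsSymmetricGauge.le_mul_one`). The moment of `‖Z‖_op` comes
without nets: the exponential of a bilinear form at its maximiser is dominated by an average over
balls (`exp_opNorm_mul_volume_le`), and the expectation of that average is an explicit Gaussian
integral.

Lower bound: give `M` the law of the noise. Then `M` and `Z` are exchangeable given `Y = M + Z`, so
for `D = est Y - M` the mean of `|⟨D, M - Z⟩|` is at least `k * s / 2`
(`le_two_mul_lintegral_abs_sum_mul`). By trace duality and averaging over cyclic shifts, `|⟨D, M -
Z⟩| τ(1) ≤ d ‖D‖_τ ‖M - Z‖_op` (`abs_sum_mul_mul_le_gaugeNorm`). As `‖M - Z‖_op²` has mean of order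
`max k s`, the mean of `‖D‖_τ²` is at least of order `max k s * τ(1)²`, and the worst-case risk
dominates this Bayes risk.

The representation of unitarily invariant norms is the singular value decomposition, with `τ` the
restriction of the norm to diagonal matrices. -/

namespace MatrixMinimax

open Matrix

variable {k s : ℕ}

/-! ### Singular value decomposition and unitarily invariant norms -/

/-- The `k × s` matrix with diagonal `x` and zeros elsewhere. -/
def rectDiagonal (k s : ℕ) (x : Fin (min k s) → ℝ) : Matrix (Fin k) (Fin s) ℝ :=
  Matrix.of fun i j =>
    if h : (i : ℕ) = j then x ⟨i, lt_min i.isLt (h ▸ j.isLt)⟩ else 0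

theorem rectDiagonal_add (x y : Fin (min k s) → ℝ) :
    rectDiagonal k s (x + y) = rectDiagonal k s x + rectDiagonal k s y := by
  ext i j
  simp only [rectDiagonal, of_apply, Matrix.add_apply, Pi.add_apply]
  split_ifs <;> simp

theorem rectDiagonal_smul (a : ℝ) (x : Fin (min k s) → ℝ) :
    rectDiagonal k s (a • x) = a • rectDiagonal k s x := by
  ext i j
  simp only [rectDiagonal, of_apply, Matrix.smul_apply, Pi.smul_apply]
  split_ifs <;> simp

theorem rectDiagonal_eq_zero_iff (x : Fin (min k s) → ℝ) : rectDiagonal k s x = 0 ↔ x = 0 := by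
  constructor
  · intro h
    ext i
    have := congrFun (congrFun h ⟨i, i.isLt.trans_le (min_le_left _ _)⟩)
      ⟨i, i.isLt.trans_le (min_le_right _ _)⟩
    simpa [rectDiagonal] using this
  · rintro rfl
    ext i j
    simp [rectDiagonal]

/-- The singular value decomposition of a linear map, in terms of orthonormal bases. -/
theorem exists_orthonormalBasis_apply_eq_singularValues_smul {E F : Type*}
    [NormedAddCommGroup E] [InnerProductSpace ℝ E] [FiniteDimensional ℝ E]
    [NormedAddCommGroup F] [InnerProductSpace ℝ F] [FiniteDimensional ℝ F]
    (hE : Module.finrank ℝ E = s) (hF : Module.finrank ℝ F = k) (T : E →ₗ[ℝ] F) :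
    ∃ (u : OrthonormalBasis (Fin k) ℝ F) (v : OrthonormalBasis (Fin s) ℝ E), ∀ i j,
      inner ℝ (u i) (T (v j)) = if (i : ℕ) = j then T.singularValues j else 0 := by
  set v := T.isSymmetric_adjoint_comp_self.eigenvectorBasis hE with hv
  have key (i j : Fin s) : inner ℝ (T (v i)) (T (v j)) =
      if i = j then T.singularValues j ^ 2 else 0 := by
    have h := T.isSymmetric_adjoint_comp_self.apply_eigenvectorBasis hE j
    rw [← hv, LinearMap.comp_apply] at h
    rw [← LinearMap.adjoint_inner_right, h, ← T.sq_singularValues_fin hE]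
    simp only [RCLike.ofReal_real_eq_id, id_eq, real_inner_smul_right,
      v.inner_eq_ite]
    split_ifs <;> simp
  have hzero (j : Fin s) (h : T.singularValues j = 0) : T (v j) = 0 := by
    have := key j j
    rw [if_pos rfl, h] at this
    simpa using this
  -- The left singular vectors. Only indices in `S` matter: the zeros elsewhere are discarded when
  -- the family on `S` is extended to an orthonormal basis.
  let w : Fin k → F := fun i =>
    if h : (i : ℕ) < s then (T.singularValues i)⁻¹ • T (v ⟨i, h⟩) else 0
  let S : Set (Fin k) := {i | 0 < T.singularValues i}
  have hlt {i : ℕ} (hi : 0 < T.singularValues i) : i < s := by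
    by_contra h
    rw [T.singularValues_of_finrank_le (by omega)] at hi
    exact hi.false
  have hlt' {i : ℕ} (hi : 0 < T.singularValues i) : i < k := by
    rw [T.singularValues_pos_iff_lt_finrank_range] at hi
    exact hi.trans_le (hF ▸ Submodule.finrank_le _)
  have hw : Orthonormal ℝ (S.domRestrict w) := by
    rw [orthonormal_iff_ite]
    rintro ⟨i, hi⟩ ⟨j, hj⟩
    have hi' : 0 < T.singularValues i := hi
    have hj' : 0 < T.singularValues j := hj
    simp only [Set.domRestrict_apply, w, hlt hi', hlt hj', dite_true, real_inner_smul_left,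
      real_inner_smul_right, key, Subtype.mk.injEq, Fin.ext_iff]
    split_ifs with h
    · rw [h]; field_simp
    · simp
  obtain ⟨u, hu⟩ := hw.exists_orthonormalBasis_extension_of_card_eq (by simp [hF])
  refine ⟨u, v, fun i j => ?_⟩
  by_cases hj : T.singularValues j = 0
  · simp [hzero j hj, hj]
  · have hj' := (T.singularValues_pos_iff_ne_zero j).2 hj
    have hT : T (v j) = T.singularValues j • u ⟨j, hlt' hj'⟩ := by
      rw [hu _ (show (⟨j, hlt' hj'⟩ : Fin k) ∈ S from hj')]
      simp [w, smul_smul, mul_inv_cancel₀ hj]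
    rw [hT, real_inner_smul_right, u.inner_eq_ite]
    simp [Fin.ext_iff]

theorem inner_toLp_toEuclideanLin (A : Matrix (Fin k) (Fin s) ℝ)
    (x : Fin k → ℝ) (y : Fin s → ℝ) :
    inner ℝ (WithLp.toLp 2 x) (Matrix.toEuclideanLin A (WithLp.toLp 2 y)) = x ⬝ᵥ A *ᵥ y := by
  simp [EuclideanSpace.inner_toLp_toLp, dotProduct_comm]

theorem transpose_mul_mul_apply {m n : ℕ} (U : Matrix (Fin k) (Fin m) ℝ)
    (A : Matrix (Fin k) (Fin s) ℝ) (V : Matrix (Fin s) (Fin n) ℝ) (i : Fin m) (j : Fin n) :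
    (Uᵀ * A * V) i j = Uᵀ i ⬝ᵥ A *ᵥ Vᵀ j := by
  rw [Matrix.mul_assoc, Matrix.mul_apply]
  rfl

/-- The singular value decomposition of a matrix. -/
theorem exists_orthogonal_mul_mul_eq_rectDiagonal (A : Matrix (Fin k) (Fin s) ℝ) :
    ∃ U ∈ orthogonalGroup (Fin k) ℝ, ∃ V ∈ orthogonalGroup (Fin s) ℝ,
      Uᵀ * A * V = rectDiagonal k s (singularVector A) := by
  obtain ⟨u, v, h⟩ := exists_orthonormalBasis_apply_eq_singularValues_smul (s := s) (k := k)
    (by simp) (by simp) (toEuclideanLin A)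
  refine ⟨_, (EuclideanSpace.basisFun (Fin k) ℝ).toMatrix_orthonormalBasis_mem_orthogonal u,
    _, (EuclideanSpace.basisFun (Fin s) ℝ).toMatrix_orthonormalBasis_mem_orthogonal v, ?_⟩
  ext i j
  rw [transpose_mul_mul_apply, ← inner_toLp_toEuclideanLin]
  have h1 : WithLp.toLp 2 (((EuclideanSpace.basisFun (Fin k) ℝ).toBasis.toMatrix u)ᵀ i) = u i := by
    ext a
    simp [Module.Basis.toMatrix_apply]
  have h2 : WithLp.toLp 2 (((EuclideanSpace.basisFun (Fin s) ℝ).toBasis.toMatrix v)ᵀ j) = v j := by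
    ext a
    simp [Module.Basis.toMatrix_apply]
  rw [h1, h2, h]
  simp only [rectDiagonal, of_apply, singularVector]
  split_ifs with hij
  · rw [hij]
  · rfl

theorem IsUnitarilyInvariantNorm.eq_rectDiagonal {N : Matrix (Fin k) (Fin s) ℝ → ℝ}
    (hN : IsUnitarilyInvariantNorm N) (A : Matrix (Fin k) (Fin s) ℝ) :
    N A = N (rectDiagonal k s (singularVector A)) := by
  obtain ⟨U, hU, V, hV, h⟩ := exists_orthogonal_mul_mul_eq_rectDiagonal A
  rw [← h, hN.invariant _ _ _ hV]
  rw [mem_orthogonalGroup_iff'] at hU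
  rwa [mem_orthogonalGroup_iff, transpose_transpose]

theorem permMatrix_mem_orthogonalGroup {n : ℕ} (π : Equiv.Perm (Fin n)) :
    π.permMatrix ℝ ∈ orthogonalGroup (Fin n) ℝ := by
  rw [mem_orthogonalGroup_iff, transpose_permMatrix, ← permMatrix_mul, inv_mul_cancel, permMatrix_one]

theorem diagonal_mem_orthogonalGroup {n : ℕ} {ε : Fin n → ℝ} (h : ∀ i, ε i = 1 ∨ ε i = -1) :
    diagonal ε ∈ orthogonalGroup (Fin n) ℝ := by
  rw [mem_orthogonalGroup_iff, diagonal_transpose, diagonal_mul_diagonal,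
    ← diagonal_one]
  congr 1
  ext i
  rcases h i with h | h <;> simp [h]

/-- Permuting coordinates and changing signs on the diagonal is multiplication by orthogonal
matrices. -/
theorem exists_orthogonal_rectDiagonal (π : Equiv.Perm (Fin (min k s))) (ε : Fin (min k s) → ℝ)
    (hε : ∀ i, ε i = 1 ∨ ε i = -1) (x : Fin (min k s) → ℝ) :
    ∃ U ∈ orthogonalGroup (Fin k) ℝ, ∃ V ∈ orthogonalGroup (Fin s) ℝ,
      U * rectDiagonal k s x * V = rectDiagonal k s fun i => ε i * x (π i) := by
  let ek : Fin (min k s) ↪ Fin k := Fin.castLEEmb (min_le_left k s)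
  let es : Fin (min k s) ↪ Fin s := Fin.castLEEmb (min_le_right k s)
  -- Signs are padded by `1` and permutations by the identity outside the leading block. All signs
  -- are put in the left factor. The right factor uses the inverse permutation because right
  -- multiplication by a permutation matrix reindexes columns by the inverse.
  let ε' : Fin k → ℝ := fun i => if h : (i : ℕ) < min k s then ε ⟨i, h⟩ else 1
  have hε' (i : Fin k) : ε' i = 1 ∨ ε' i = -1 := by
    by_cases h : (i : ℕ) < min k s
    · simpa only [ε', dif_pos h] using hε _
    · simp only [ε', dif_neg h, true_or]
  refine ⟨diagonal ε' * (π.viaEmbedding ek).permMatrix ℝ,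
    mul_mem (diagonal_mem_orthogonalGroup hε') (permMatrix_mem_orthogonalGroup _),
    ((π.viaEmbedding es)⁻¹).permMatrix ℝ, permMatrix_mem_orthogonalGroup _, ?_⟩
  have hk (i : Fin k) (h : (i : ℕ) < min k s) :
      ((π.viaEmbedding ek i : Fin k) : ℕ) = π ⟨i, h⟩ :=
    congrArg Fin.val (π.viaEmbedding_apply ek ⟨i, h⟩)
  have hk' (i : Fin k) (h : ¬ (i : ℕ) < min k s) : π.viaEmbedding ek i = i :=
    π.viaEmbedding_apply_of_notMem ek i (by rintro ⟨a, rfl⟩; exact h a.isLt)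
  have hs (i : Fin s) (h : (i : ℕ) < min k s) :
      ((π.viaEmbedding es i : Fin s) : ℕ) = π ⟨i, h⟩ :=
    congrArg Fin.val (π.viaEmbedding_apply es ⟨i, h⟩)
  have hs' (i : Fin s) (h : ¬ (i : ℕ) < min k s) : π.viaEmbedding es i = i :=
    π.viaEmbedding_apply_of_notMem es i (by rintro ⟨a, rfl⟩; exact h a.isLt)
  ext i j
  rw [Matrix.mul_assoc, Matrix.mul_assoc, diagonal_mul, PEquiv.toMatrix_toPEquiv_mul,
    PEquiv.mul_toMatrix_toPEquiv]
  simp only [submatrix_apply, id, Equiv.Perm.inv_def, Equiv.symm_symm, rectDiagonal, of_apply]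
  by_cases hi : (i : ℕ) < min k s
  · by_cases hj : (j : ℕ) < min k s
    · have h1 := hk i hi
      have h2 := hs j hj
      by_cases hij : (i : ℕ) = j
      · have h3 : ((π.viaEmbedding ek i : Fin k) : ℕ) = (π.viaEmbedding es j : Fin s) := by
          rw [h1, h2]; simp [hij]
        rw [dif_pos hij, dif_pos h3]
        simp only [ε', dif_pos hi, h1, Fin.eta]
      · have h3 : ¬ ((π.viaEmbedding ek i : Fin k) : ℕ) = (π.viaEmbedding es j : Fin s) := by
          rw [h1, h2]
          intro h
          exact hij (by simpa using π.injective (Fin.ext h))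
        rw [dif_neg hij, dif_neg h3, mul_zero]
    · have h1 := hk i hi
      have h2 := (π ⟨i, hi⟩).isLt
      rw [dif_neg, dif_neg, mul_zero]
      · omega
      · rw [h1, hs' j hj]; omega
  · have := i.isLt
    have := j.isLt
    by_cases hj : (j : ℕ) < min k s
    · have h1 := hs j hj
      have h2 := (π ⟨j, hj⟩).isLt
      rw [dif_neg, dif_neg, mul_zero]
      · omega
      · rw [h1, hk' i hi]; omega
    · rw [dif_neg, dif_neg, mul_zero]
      · omega
      · rw [hs' j hj, hk' i hi]; omega

/-- Every unitarily invariant norm comes from a symmetric gauge function. -/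
theorem IsUnitarilyInvariantNorm.exists_eq_gaugeNorm {N : Matrix (Fin k) (Fin s) ℝ → ℝ}
    (hN : IsUnitarilyInvariantNorm N) :
    ∃ τ : (Fin (min k s) → ℝ) → ℝ, IsSymmetricGauge τ ∧ ∀ A, N A = gaugeNorm τ A := by
  refine ⟨fun x => N (rectDiagonal k s x), ⟨⟨fun x => hN.nonneg _, fun x => ?_, fun a x => ?_,
    fun x y => ?_⟩, fun π ε hε x => ?_⟩, fun A => hN.eq_rectDiagonal A⟩
  · rw [hN.eq_zero_iff, rectDiagonal_eq_zero_iff]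
  · rw [rectDiagonal_smul, hN.smul]
  · rw [rectDiagonal_add]; exact hN.add_le _ _
  · obtain ⟨U, hU, V, hV, h⟩ := exists_orthogonal_rectDiagonal π ε hε x
    simp only [← h, hN.invariant U hU V hV]

/-! ### Operator norm and trace duality -/

/-- The operator norm of a matrix with respect to the Euclidean norms. -/
noncomputable def opNorm (A : Matrix (Fin k) (Fin s) ℝ) : ℝ :=
  ‖(toEuclideanLin A).toContinuousLinearMap‖

theorem opNorm_nonneg (A : Matrix (Fin k) (Fin s) ℝ) : 0 ≤ opNorm A := norm_nonneg _

theorem opNorm_neg (A : Matrix (Fin k) (Fin s) ℝ) : opNorm (-A) = opNorm A := by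
  simp only [opNorm, map_neg, norm_neg]

theorem opNorm_sub_le (A B : Matrix (Fin k) (Fin s) ℝ) : opNorm (A - B) ≤ opNorm A + opNorm B := by
  simp only [opNorm, map_sub]
  exact norm_sub_le _ _

theorem continuous_opNorm : Continuous (opNorm : Matrix (Fin k) (Fin s) ℝ → ℝ) :=
  (((toEuclideanLin (𝕜 := ℝ) (m := Fin k) (n := Fin s)).trans
    LinearMap.toContinuousLinearMap).toLinearMap.continuous_of_finiteDimensional).norm

theorem inner_toEuclideanLin_le (A : Matrix (Fin k) (Fin s) ℝ)
    {x : EuclideanSpace ℝ (Fin k)} {y : EuclideanSpace ℝ (Fin s)} (hx : ‖x‖ ≤ 1) (hy : ‖y‖ ≤ 1) :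
    inner ℝ x (toEuclideanLin A y) ≤ opNorm A := by
  have h1 : ‖toEuclideanLin A y‖ ≤ opNorm A :=
    (toEuclideanLin A).toContinuousLinearMap.unit_le_opNorm y hy
  calc _ ≤ ‖x‖ * ‖toEuclideanLin A y‖ := real_inner_le_norm _ _
    _ ≤ 1 * opNorm A := by gcongr
    _ = opNorm A := one_mul _

theorem exists_inner_toEuclideanLin_eq_opNorm (A : Matrix (Fin k) (Fin s) ℝ) :
    ∃ (x : EuclideanSpace ℝ (Fin k)) (y : EuclideanSpace ℝ (Fin s)), ‖x‖ ≤ 1 ∧ ‖y‖ ≤ 1 ∧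
      opNorm A ≤ inner ℝ x (toEuclideanLin A y) := by
  obtain ⟨y, hy, hmax⟩ := (isCompact_closedBall (0 : EuclideanSpace ℝ (Fin s)) 1).exists_isMaxOn
    ⟨0, by simp⟩ (f := fun y => ‖toEuclideanLin A y‖)
    (toEuclideanLin A).toContinuousLinearMap.continuous.norm.continuousOn
  -- If the image of `y` vanishes, the first witness is `0`; hence unit balls rather than spheres.
  refine ⟨‖toEuclideanLin A y‖⁻¹ • toEuclideanLin A y, y, ?_, by simpa using hy, ?_⟩
  · rw [norm_smul, norm_inv, norm_norm]
    exact inv_mul_le_one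
  · rw [real_inner_smul_left, real_inner_self_eq_norm_sq]
    have h1 : opNorm A ≤ ‖toEuclideanLin A y‖ := by
      refine ContinuousLinearMap.opNorm_le_of_unit_norm (norm_nonneg _) fun z hz => ?_
      exact hmax (by simp [hz])
    rcases eq_or_ne ‖toEuclideanLin A y‖ 0 with h0 | h0
    · rw [h0] at h1 ⊢; simpa using h1
    · rwa [pow_two, inv_mul_cancel_left₀ h0]

theorem norm_toLp_transpose_of_mem_orthogonalGroup {n : ℕ} {U : Matrix (Fin n) (Fin n) ℝ}
    (hU : U ∈ orthogonalGroup (Fin n) ℝ) (i : Fin n) : ‖WithLp.toLp 2 (Uᵀ i)‖ = 1 := by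
  rw [mem_orthogonalGroup_iff'] at hU
  have := congrFun (congrFun hU i) i
  rw [Matrix.mul_apply, one_apply_eq] at this
  rw [EuclideanSpace.norm_eq, Real.sqrt_eq_one, ← this]
  simp [pow_two]

theorem transpose_mul_mul_apply_le_opNorm {U : Matrix (Fin k) (Fin k) ℝ}
    (hU : U ∈ orthogonalGroup (Fin k) ℝ) {V : Matrix (Fin s) (Fin s) ℝ}
    (hV : V ∈ orthogonalGroup (Fin s) ℝ) (A : Matrix (Fin k) (Fin s) ℝ) (i : Fin k) (j : Fin s) :
    (Uᵀ * A * V) i j ≤ opNorm A := by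
  rw [transpose_mul_mul_apply, ← inner_toLp_toEuclideanLin]
  exact inner_toEuclideanLin_le A (norm_toLp_transpose_of_mem_orthogonalGroup hU i).le
    (norm_toLp_transpose_of_mem_orthogonalGroup hV j).le

theorem singularVector_nonneg (A : Matrix (Fin k) (Fin s) ℝ) (i : Fin (min k s)) :
    0 ≤ singularVector A i :=
  LinearMap.singularValues_nonneg _ _

theorem singularVector_le_opNorm (A : Matrix (Fin k) (Fin s) ℝ) (i : Fin (min k s)) :
    singularVector A i ≤ opNorm A := by
  obtain ⟨U, hU, V, hV, h⟩ := exists_orthogonal_mul_mul_eq_rectDiagonal A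
  have := transpose_mul_mul_apply_le_opNorm hU hV A (Fin.castLE (min_le_left k s) i)
    (Fin.castLE (min_le_right k s) i)
  rw [h] at this
  simpa [rectDiagonal] using this

theorem sum_rectDiagonal_mul (x : Fin (min k s) → ℝ) (B : Matrix (Fin k) (Fin s) ℝ) :
    ∑ i, ∑ j, rectDiagonal k s x i j * B i j =
      ∑ i, x i * B (Fin.castLE (min_le_left k s) i) (Fin.castLE (min_le_right k s) i) := by
  rw [← Fintype.sum_prod_type', eq_comm]
  refine Finset.sum_of_injOn
    (fun i => (Fin.castLE (min_le_left k s) i, Fin.castLE (min_le_right k s) i)) ?_ (by simp)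
    ?_ ?_
  · intro i _ j _ h
    simpa using h
  · rintro ⟨i, j⟩ - h
    have hij : (i : ℕ) ≠ j := by
      intro hij
      refine h ⟨⟨i, lt_min i.isLt (hij ▸ j.isLt)⟩, by simp, ?_⟩
      ext <;> simp [hij]
    simp [rectDiagonal, hij]
  · intro i _
    simp [rectDiagonal]

theorem sum_transpose_mul_mul_mul {U : Matrix (Fin k) (Fin k) ℝ}
    (hU : U ∈ orthogonalGroup (Fin k) ℝ) {V : Matrix (Fin s) (Fin s) ℝ}
    (hV : V ∈ orthogonalGroup (Fin s) ℝ) (A B : Matrix (Fin k) (Fin s) ℝ) :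
    ∑ i, ∑ j, (Uᵀ * A * V) i j * (Uᵀ * B * V) i j = ∑ i, ∑ j, A i j * B i j := by
  have key (X Y : Matrix (Fin k) (Fin s) ℝ) : ∑ i, ∑ j, X i j * Y i j = (X * Yᵀ).trace := by
    simp [trace, Matrix.mul_apply]
  rw [mem_orthogonalGroup_iff] at hU hV
  rw [key, key]
  calc _ = (Uᵀ * (A * (V * Vᵀ) * Bᵀ * U)).trace := by
        simp only [transpose_mul, transpose_transpose, Matrix.mul_assoc]
    _ = (A * Bᵀ * (U * Uᵀ)).trace := by
        rw [Matrix.trace_mul_comm, hV, Matrix.mul_one, Matrix.mul_assoc]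
    _ = _ := by rw [hU, Matrix.mul_one]

/-- Duality of the nuclear and operator norms. -/
theorem sum_mul_le_sum_singularVector_mul_opNorm (A B : Matrix (Fin k) (Fin s) ℝ) :
    ∑ i, ∑ j, A i j * B i j ≤ (∑ i, singularVector A i) * opNorm B := by
  obtain ⟨U, hU, V, hV, h⟩ := exists_orthogonal_mul_mul_eq_rectDiagonal A
  rw [← sum_transpose_mul_mul_mul hU hV, h, sum_rectDiagonal_mul, Finset.sum_mul]
  exact Finset.sum_le_sum fun i _ => mul_le_mul_of_nonneg_left
    (transpose_mul_mul_apply_le_opNorm hU hV B _ _) (singularVector_nonneg A i)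

/-! ### Symmetric gauges against the sup and `ℓ¹` norms -/

theorem IsNorm.sum_le {V ι : Type*} [AddCommGroup V] [Module ℝ V] {N : V → ℝ} (hN : IsNorm N)
    (t : Finset ι) (f : ι → V) : N (∑ i ∈ t, f i) ≤ ∑ i ∈ t, N (f i) :=
  Finset.le_sum_of_subadditive N ((hN.eq_zero_iff 0).2 rfl).le hN.add_le t f

/-- The cube `[-b, b]^d` is the convex hull of its vertices; sublevel sets of `τ` are convex, and by
sign invariance every vertex has gauge `b * τ 1`. -/
theorem IsSymmetricGauge.le_mul_one {d : ℕ} {τ : (Fin d → ℝ) → ℝ} (hτ : IsSymmetricGauge τ)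
    {b : ℝ} {x : Fin d → ℝ} (hx : ∀ i, |x i| ≤ b) : τ x ≤ b * τ fun _ => 1 := by
  rcases isEmpty_or_nonempty (Fin d) with hd | ⟨⟨i0⟩⟩
  · rw [(hτ.eq_zero_iff x).2 (Subsingleton.elim _ _),
      (hτ.eq_zero_iff _).2 (Subsingleton.elim _ _), mul_zero]
  have hb : 0 ≤ b := (abs_nonneg _).trans (hx i0)
  have hconv : Convex ℝ {x | τ x ≤ b * τ fun _ => 1} := by
    intro x hx y hy p q hp hq hpq
    calc τ (p • x + q • y) ≤ p * τ x + q * τ y := by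
          refine (hτ.add_le _ _).trans_eq ?_
          rw [hτ.smul, hτ.smul, abs_of_nonneg hp, abs_of_nonneg hq]
      _ ≤ p * (b * τ fun _ => 1) + q * (b * τ fun _ => 1) := by
          gcongr
          · exact hx
          · exact hy
      _ = _ := by rw [← add_mul, hpq, one_mul]
  have hmem : x ∈ convexHull ℝ (Set.univ.pi fun _ : Fin d => ({-b, b} : Set ℝ)) := by
    rw [convexHull_pi]
    intro i _
    rw [convexHull_pair, segment_eq_Icc (by linarith)]
    exact abs_le.1 (hx i)
  refine convexHull_min ?_ hconv hmem
  intro y hy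
  have hy' (i : Fin d) : ∃ e : ℝ, (e = 1 ∨ e = -1) ∧ y i = b * e := by
    rcases hy i trivial with h | h
    · exact ⟨-1, Or.inr rfl, by rw [h]; ring⟩
    · exact ⟨1, Or.inl rfl, by rw [Set.mem_singleton_iff.1 h]; ring⟩
  choose e he hye using hy'
  have h1 : y = b • fun i => e i * 1 := by
    ext i
    simp [hye]
  have h2 := hτ.invariant 1 e he fun _ => 1
  rw [Set.mem_ofPred_eq, h1, hτ.smul, abs_of_nonneg hb, h2]

/-- The `d` cyclic shifts of `x` add up to the constant vector `∑ i, x i`, and each has the same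
gauge as `x`; the triangle inequality does the rest. The factors `1 *` are the trivial signs in
`invariant`. -/
theorem IsSymmetricGauge.sum_mul_one_le {d : ℕ} {τ : (Fin d → ℝ) → ℝ} (hτ : IsSymmetricGauge τ)
    (x : Fin d → ℝ) : (∑ i, x i) * (τ fun _ => 1) ≤ d * τ x := by
  rcases Nat.eq_zero_or_pos d with rfl | hd
  · simp
  have : NeZero d := ⟨hd.ne'⟩
  have h1 : ((∑ i, x i) • fun _ : Fin d => (1 : ℝ)) = ∑ c : Fin d, fun i => 1 * x (i + c) := by
    ext i
    simp only [Pi.smul_apply, smul_eq_mul, mul_one, Finset.sum_apply, one_mul]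
    exact (Equiv.sum_comp (Equiv.addLeft i) x).symm
  have h2 := hτ.sum_le Finset.univ fun (c : Fin d) i => 1 * x (i + c)
  rw [← h1, hτ.smul] at h2
  have h3 (c : Fin d) : (τ fun i => 1 * x (i + c)) = τ x :=
    hτ.invariant (Equiv.addRight c) (fun _ => 1) (fun _ => Or.inl rfl) x
  simp only [h3, Finset.sum_const, Finset.card_univ, Fintype.card_fin, nsmul_eq_mul] at h2
  exact (mul_le_mul_of_nonneg_right (le_abs_self _) (hτ.nonneg _)).trans h2

theorem gaugeNorm_nonneg {τ : (Fin (min k s) → ℝ) → ℝ} (hτ : IsSymmetricGauge τ)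
    (A : Matrix (Fin k) (Fin s) ℝ) : 0 ≤ gaugeNorm τ A := hτ.nonneg _

theorem gaugeNorm_le_opNorm_mul {τ : (Fin (min k s) → ℝ) → ℝ} (hτ : IsSymmetricGauge τ)
    (A : Matrix (Fin k) (Fin s) ℝ) : gaugeNorm τ A ≤ opNorm A * τ fun _ => 1 :=
  hτ.le_mul_one fun i => by
    rw [abs_of_nonneg (singularVector_nonneg A i)]
    exact singularVector_le_opNorm A i

/-- Trace duality bounds the pairing by the nuclear norm of `A`, which `sum_mul_one_le` turns into
`‖A‖_τ`. This lets the lower bound treat all `τ` at once, using only the operator norm of `B`. -/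
theorem abs_sum_mul_mul_le_gaugeNorm {τ : (Fin (min k s) → ℝ) → ℝ} (hτ : IsSymmetricGauge τ)
    (A B : Matrix (Fin k) (Fin s) ℝ) :
    |∑ i, ∑ j, A i j * B i j| * (τ fun _ => 1) ≤ (min k s : ℕ) * gaugeNorm τ A * opNorm B := by
  have h1 : |∑ i, ∑ j, A i j * B i j| ≤ (∑ i, singularVector A i) * opNorm B := by
    refine abs_le'.2 ⟨sum_mul_le_sum_singularVector_mul_opNorm A B, ?_⟩
    have := sum_mul_le_sum_singularVector_mul_opNorm A (-B)
    simpa [opNorm_neg] using this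
  calc _ ≤ (∑ i, singularVector A i) * opNorm B * (τ fun _ => 1) :=
        mul_le_mul_of_nonneg_right h1 (hτ.nonneg _)
    _ = (∑ i, singularVector A i) * (τ fun _ => 1) * opNorm B := by ring
    _ ≤ _ := mul_le_mul_of_nonneg_right (hτ.sum_mul_one_le _) (opNorm_nonneg B)

/-! ### Gaussian noise and its moment generating function -/

instance instBorelSpaceMatrix (k s : ℕ) : BorelSpace (Matrix (Fin k) (Fin s) ℝ) :=
  inferInstanceAs (BorelSpace (Fin k → Fin s → ℝ))

instance instSecondCountableTopologyMatrix (k s : ℕ) :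
    SecondCountableTopology (Matrix (Fin k) (Fin s) ℝ) :=
  inferInstanceAs (SecondCountableTopology (Fin k → Fin s → ℝ))

instance instIsProbabilityMeasureGaussianNoise (k s : ℕ) :
    IsProbabilityMeasure (gaussianNoise k s) := by
  unfold gaussianNoise
  exact Measure.isProbabilityMeasure_map (measurable_matrix_of k s).aemeasurable

/-- The moment generating function of the Gaussian noise. -/
theorem lintegral_exp_gaussianNoise (t : Fin k → Fin s → ℝ) :
    ∫⁻ Z, ENNReal.ofReal (Real.exp (∑ i, ∑ j, t i j * Z i j)) ∂(gaussianNoise k s) =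
      ENNReal.ofReal (Real.exp ((∑ i, ∑ j, t i j ^ 2) / 2)) := by
  have hm : Measurable fun Z : Matrix (Fin k) (Fin s) ℝ =>
      ENNReal.ofReal (Real.exp (∑ i, ∑ j, t i j * Z i j)) :=
    (Continuous.measurable (f := fun Z : Matrix (Fin k) (Fin s) ℝ =>
      Real.exp (∑ i, ∑ j, t i j * Z i j)) (by fun_prop)).ennreal_ofReal
  rw [gaussianNoise, lintegral_map hm (measurable_matrix_of k s)]
  simp only [of_apply]
  have hexp (Z : Fin k → Fin s → ℝ) : Real.exp (∑ i, ∑ j, t i j * Z i j) =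
      ∏ i, ∏ j, Real.exp (t i j * Z i j) := by
    simp_rw [Real.exp_sum]
  have hrow (i : Fin k) : Integrable (fun z : Fin s → ℝ => ∏ j, Real.exp (t i j * z j))
      (Measure.pi fun _ : Fin s => gaussianReal 0 1) :=
    Integrable.fintype_prod (μ := fun _ => gaussianReal 0 1)
      (f := fun j (z : ℝ) => Real.exp (t i j * z)) fun j => integrable_exp_mul_gaussianReal _
  have hint : Integrable (fun Z : Fin k → Fin s → ℝ => ∏ i, ∏ j, Real.exp (t i j * Z i j))
      (Measure.pi fun _ : Fin k => Measure.pi fun _ : Fin s => gaussianReal 0 1) :=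
    Integrable.fintype_prod (μ := fun _ => Measure.pi fun _ : Fin s => gaussianReal 0 1)
      (f := fun i (z : Fin s → ℝ) => ∏ j, Real.exp (t i j * z j)) hrow
  simp_rw [hexp]
  rw [← ofReal_integral_eq_lintegral_ofReal hint (ae_of_all _ fun Z =>
    Finset.prod_nonneg fun i _ => Finset.prod_nonneg fun j _ => (Real.exp_pos _).le)]
  congr 1
  rw [integral_fintype_prod_eq_prod (fun i (z : Fin s → ℝ) => ∏ j, Real.exp (t i j * z j)),
    Finset.sum_div, Real.exp_sum]
  refine Finset.prod_congr rfl fun i _ => ?_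
  rw [integral_fintype_prod_eq_prod (fun j (z : ℝ) => Real.exp (t i j * z)),
    Finset.sum_div, Real.exp_sum]
  refine Finset.prod_congr rfl fun j _ => ?_
  have := congrFun (mgf_id_gaussianReal (μ := 0) (v := 1)) (t i j)
  simpa [mgf] using this

/-! ### Moments of the operator norm by smoothing over balls -/

section Smoothing

variable {E : Type*} [NormedAddCommGroup E] [InnerProductSpace ℝ E] [FiniteDimensional ℝ E]
  [MeasurableSpace E] [BorelSpace E]

/-- A midpoint-convex function is at most its average over a unit ball, which lies in the ball of
radius two about the origin. -/
theorem mul_volume_ball_le_lintegral {f : E → ℝ≥0∞} (hf : Measurable f)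
    (hconv : ∀ x h, 2 * f x ≤ f (x + h) + f (x - h)) {x : E} (hx : ‖x‖ ≤ 1) :
    f x * volume (Metric.ball (0 : E) 1) ≤ ∫⁻ y in Metric.ball (0 : E) 2, f y := by
  set g : E → ℝ≥0∞ := (Metric.ball (0 : E) 2).indicator f with hg
  have hgm : Measurable g := hf.indicator measurableSet_ball
  have h1 : ∫⁻ h in Metric.ball (0 : E) 1, f (x + h) ≤ ∫⁻ y in Metric.ball (0 : E) 2, f y := by
    calc _ = ∫⁻ h in Metric.ball (0 : E) 1, g (x + h) := by
          refine setLIntegral_congr_fun measurableSet_ball fun h hh => ?_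
          rw [mem_ball_zero_iff] at hh
          rw [hg, Set.indicator_of_mem]
          rw [mem_ball_zero_iff]
          linarith [norm_add_le x h]
      _ ≤ ∫⁻ h, g (x + h) := setLIntegral_le_lintegral _ _
      _ = ∫⁻ h, g h := lintegral_add_left_eq_self g x
      _ = _ := lintegral_indicator measurableSet_ball f
  have h2 : ∫⁻ h in Metric.ball (0 : E) 1, f (x - h) = ∫⁻ h in Metric.ball (0 : E) 1, f (x + h) := by
    rw [← lintegral_indicator measurableSet_ball, ← lintegral_indicator measurableSet_ball,
      ← lintegral_neg_eq_self]
    refine lintegral_congr fun h => ?_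
    simp [Set.indicator, sub_eq_add_neg]
  have h3 : 2 * (f x * volume (Metric.ball (0 : E) 1)) ≤
      2 * ∫⁻ y in Metric.ball (0 : E) 2, f y := by
    calc _ = ∫⁻ _ in Metric.ball (0 : E) 1, 2 * f x := by rw [setLIntegral_const, mul_assoc]
      _ ≤ ∫⁻ h in Metric.ball (0 : E) 1, (f (x + h) + f (x - h)) :=
          lintegral_mono fun h => hconv x h
      _ = (∫⁻ h in Metric.ball (0 : E) 1, f (x + h)) + ∫⁻ h in Metric.ball (0 : E) 1, f (x - h) :=
          lintegral_add_left (hf.comp (measurable_const_add x)) _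
      _ ≤ _ := by rw [h2, two_mul]; gcongr
  exact (ENNReal.mul_le_mul_iff_right (by simp) (by simp)).1 h3

/-- Midpoint convexity of `exp ∘ L` is the inequality `cosh ≥ 1`. -/
theorem exp_linear_mul_volume_ball_le_lintegral (L : E →ₗ[ℝ] ℝ) {x : E} (hx : ‖x‖ ≤ 1) :
    ENNReal.ofReal (Real.exp (L x)) * volume (Metric.ball (0 : E) 1) ≤
      ∫⁻ y in Metric.ball (0 : E) 2, ENNReal.ofReal (Real.exp (L y)) := by
  refine mul_volume_ball_le_lintegral (f := fun y => ENNReal.ofReal (Real.exp (L y))) ?_ ?_ hx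
  · exact (Real.continuous_exp.comp L.continuous_of_finiteDimensional).measurable.ennreal_ofReal
  · intro y h
    rw [← ENNReal.ofReal_add (Real.exp_pos _).le (Real.exp_pos _).le, ← ENNReal.ofReal_ofNat 2,
      ← ENNReal.ofReal_mul (by norm_num)]
    refine ENNReal.ofReal_le_ofReal ?_
    rw [map_add, map_sub, sub_eq_add_neg, Real.exp_add, Real.exp_add]
    have h1 : Real.exp (L h) * Real.exp (-L h) = 1 := by rw [← Real.exp_add]; simp
    have h2 : 2 ≤ Real.exp (L h) + Real.exp (-L h) := by
      nlinarith [sq_nonneg (Real.exp (L h) - 1), Real.exp_pos (L h), Real.exp_pos (-L h),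
        sq_nonneg (Real.exp (L h) - Real.exp (-L h))]
    nlinarith [Real.exp_pos (L y)]

end Smoothing

/-- The supremum over `x` and `y` is replaced by an integral: the smoothing bound is applied to the
maximising pair in one variable at a time, the form being linear in each. Unlike the maximiser, the
domain of integration does not depend on `A`, so expectation and integral can be exchanged. -/
theorem exp_opNorm_mul_volume_le (A : Matrix (Fin k) (Fin s) ℝ) {l : ℝ} (hl : 0 ≤ l) :
    ENNReal.ofReal (Real.exp (l * opNorm A)) *
      (volume (Metric.ball (0 : EuclideanSpace ℝ (Fin s)) 1) *
        volume (Metric.ball (0 : EuclideanSpace ℝ (Fin k)) 1)) ≤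
      ∫⁻ x in Metric.ball (0 : EuclideanSpace ℝ (Fin k)) 2,
        ∫⁻ y in Metric.ball (0 : EuclideanSpace ℝ (Fin s)) 2,
          ENNReal.ofReal (Real.exp (l * inner ℝ x (toEuclideanLin A y))) := by
  obtain ⟨x, y, hx, hy, h⟩ := exists_inner_toEuclideanLin_eq_opNorm A
  have h1 := exp_linear_mul_volume_ball_le_lintegral (l • innerₗ _ (toEuclideanLin A y)) hx
  have h2 (z : EuclideanSpace ℝ (Fin k)) := exp_linear_mul_volume_ball_le_lintegral
    (l • (innerₗ _ z).comp (toEuclideanLin A)) hy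
  simp only [LinearMap.smul_apply, smul_eq_mul, innerₗ_apply_apply, LinearMap.comp_apply] at h1 h2
  simp only [real_inner_comm _ (toEuclideanLin A y)] at h1
  calc _ ≤ ENNReal.ofReal (Real.exp (l * inner ℝ x (toEuclideanLin A y))) *
      (volume (Metric.ball (0 : EuclideanSpace ℝ (Fin s)) 1) *
        volume (Metric.ball (0 : EuclideanSpace ℝ (Fin k)) 1)) := by gcongr
    _ = (ENNReal.ofReal (Real.exp (l * inner ℝ x (toEuclideanLin A y))) *
        volume (Metric.ball (0 : EuclideanSpace ℝ (Fin k)) 1)) *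
      volume (Metric.ball (0 : EuclideanSpace ℝ (Fin s)) 1) := by ring
    _ ≤ (∫⁻ z in Metric.ball (0 : EuclideanSpace ℝ (Fin k)) 2,
          ENNReal.ofReal (Real.exp (l * inner ℝ z (toEuclideanLin A y)))) *
        volume (Metric.ball (0 : EuclideanSpace ℝ (Fin s)) 1) := by gcongr
    _ = ∫⁻ z in Metric.ball (0 : EuclideanSpace ℝ (Fin k)) 2,
          ENNReal.ofReal (Real.exp (l * inner ℝ z (toEuclideanLin A y))) *
        volume (Metric.ball (0 : EuclideanSpace ℝ (Fin s)) 1) :=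
      (lintegral_mul_const' _ _ measure_ball_lt_top.ne).symm
    _ ≤ _ := lintegral_mono fun z => h2 z

theorem lintegral_exp_inner_gaussianNoise (l : ℝ) (x : EuclideanSpace ℝ (Fin k))
    (y : EuclideanSpace ℝ (Fin s)) :
    ∫⁻ Z, ENNReal.ofReal (Real.exp (l * inner ℝ x (toEuclideanLin Z y))) ∂(gaussianNoise k s) =
      ENNReal.ofReal (Real.exp (l ^ 2 * ‖x‖ ^ 2 * ‖y‖ ^ 2 / 2)) := by
  have h1 (Z : Matrix (Fin k) (Fin s) ℝ) : l * inner ℝ x (toEuclideanLin Z y) =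
      ∑ i, ∑ j, (l * x i * y j) * Z i j := by
    have := inner_toLp_toEuclideanLin Z (WithLp.ofLp x) (WithLp.ofLp y)
    rw [WithLp.toLp_ofLp, WithLp.toLp_ofLp] at this
    rw [this, dotProduct, Finset.mul_sum]
    refine Finset.sum_congr rfl fun i _ => ?_
    rw [mulVec, dotProduct, Finset.mul_sum, Finset.mul_sum]
    exact Finset.sum_congr rfl fun j _ => by ring
  simp_rw [h1]
  rw [lintegral_exp_gaussianNoise]
  congr 3
  rw [EuclideanSpace.real_norm_sq_eq, EuclideanSpace.real_norm_sq_eq, mul_assoc,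
    Finset.sum_mul_sum, Finset.mul_sum]
  refine Finset.sum_congr rfl fun i _ => ?_
  rw [Finset.mul_sum]
  exact Finset.sum_congr rfl fun j _ => by ring

theorem measurable_exp_inner (l : ℝ) : Measurable
    fun p : Matrix (Fin k) (Fin s) ℝ × EuclideanSpace ℝ (Fin k) × EuclideanSpace ℝ (Fin s) =>
      ENNReal.ofReal (Real.exp (l * inner ℝ p.2.1 (toEuclideanLin p.1 p.2.2))) := by
  have h : Continuous fun p : Matrix (Fin k) (Fin s) ℝ × EuclideanSpace ℝ (Fin k) ×
      EuclideanSpace ℝ (Fin s) => toEuclideanLin p.1 p.2.2 := by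
    simp only [toLpLin_apply]
    refine (PiLp.continuous_toLp 2 _).comp ?_
    exact continuous_fst.matrix_mulVec ((PiLp.continuous_ofLp 2 _).comp (by fun_prop))
  have h' : Continuous fun p : Matrix (Fin k) (Fin s) ℝ × EuclideanSpace ℝ (Fin k) ×
      EuclideanSpace ℝ (Fin s) => Real.exp (l * inner ℝ p.2.1 (toEuclideanLin p.1 p.2.2)) := by
    fun_prop
  exact h'.measurable.ennreal_ofReal

/-- An exponential moment of the operator norm of the Gaussian noise. -/
theorem lintegral_exp_opNorm_gaussianNoise_le (k s : ℕ) {l : ℝ} (hl : 0 ≤ l) :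
    ∫⁻ Z, ENNReal.ofReal (Real.exp (l * opNorm Z)) ∂(gaussianNoise k s) ≤
      ENNReal.ofReal (2 ^ (k + s) * Real.exp (8 * l ^ 2)) := by
  set Vk := volume (Metric.ball (0 : EuclideanSpace ℝ (Fin k)) 1) with hVk
  set Vs := volume (Metric.ball (0 : EuclideanSpace ℝ (Fin s)) 1) with hVs
  have hk0 : Vk ≠ 0 := (Metric.measure_ball_pos _ _ one_pos).ne'
  have hs0 : Vs ≠ 0 := (Metric.measure_ball_pos _ _ one_pos).ne'
  have hk1 : Vk ≠ ∞ := measure_ball_lt_top.ne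
  have hs1 : Vs ≠ ∞ := measure_ball_lt_top.ne
  -- Doubling the radius costs `2 ^ k` in volume, likewise `2 ^ s`: together the prefactor `2 ^ (k +
  -- s)`.
  have hVk2 : volume (Metric.ball (0 : EuclideanSpace ℝ (Fin k)) 2) =
      ENNReal.ofReal (2 ^ k) * Vk := by
    rw [Measure.addHaar_ball_of_pos _ _ two_pos]; simp [hVk]
  have hVs2 : volume (Metric.ball (0 : EuclideanSpace ℝ (Fin s)) 2) =
      ENNReal.ofReal (2 ^ s) * Vs := by
    rw [Measure.addHaar_ball_of_pos _ _ two_pos]; simp [hVs]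
  rw [← ENNReal.mul_le_mul_iff_left (mul_ne_zero hs0 hk0) (ENNReal.mul_ne_top hs1 hk1)]
  have hm := measurable_exp_inner (k := k) (s := s) l
  calc _ = ∫⁻ Z, ENNReal.ofReal (Real.exp (l * opNorm Z)) * (Vs * Vk) ∂(gaussianNoise k s) :=
        (lintegral_mul_const' _ _ (ENNReal.mul_ne_top hs1 hk1)).symm
    _ ≤ ∫⁻ Z, (∫⁻ x in Metric.ball (0 : EuclideanSpace ℝ (Fin k)) 2,
        ∫⁻ y in Metric.ball (0 : EuclideanSpace ℝ (Fin s)) 2,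
          ENNReal.ofReal (Real.exp (l * inner ℝ x (toEuclideanLin Z y)))) ∂(gaussianNoise k s) :=
        lintegral_mono fun Z => exp_opNorm_mul_volume_le Z hl
    _ = ∫⁻ x in Metric.ball (0 : EuclideanSpace ℝ (Fin k)) 2, ∫⁻ Z,
        (∫⁻ y in Metric.ball (0 : EuclideanSpace ℝ (Fin s)) 2,
          ENNReal.ofReal (Real.exp (l * inner ℝ x (toEuclideanLin Z y)))) ∂(gaussianNoise k s) := by
        refine lintegral_lintegral_swap (Measurable.aemeasurable ?_)
        exact Measurable.lintegral_prod_right' (f := fun q : (Matrix (Fin k) (Fin s) ℝ ×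
          EuclideanSpace ℝ (Fin k)) × EuclideanSpace ℝ (Fin s) =>
            ENNReal.ofReal (Real.exp (l * inner ℝ q.1.2 (toEuclideanLin q.1.1 q.2))))
          (hm.comp (f := fun q : (Matrix (Fin k) (Fin s) ℝ × EuclideanSpace ℝ (Fin k)) ×
            EuclideanSpace ℝ (Fin s) => (q.1.1, q.1.2, q.2)) (by fun_prop))
    _ = ∫⁻ x in Metric.ball (0 : EuclideanSpace ℝ (Fin k)) 2,
        ∫⁻ y in Metric.ball (0 : EuclideanSpace ℝ (Fin s)) 2, ∫⁻ Z,
          ENNReal.ofReal (Real.exp (l * inner ℝ x (toEuclideanLin Z y))) ∂(gaussianNoise k s) := by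
        refine lintegral_congr fun x => lintegral_lintegral_swap (Measurable.aemeasurable ?_)
        exact hm.comp (f := fun q : Matrix (Fin k) (Fin s) ℝ × EuclideanSpace ℝ (Fin s) =>
          (q.1, x, q.2)) (by fun_prop)
    _ ≤ ∫⁻ x in Metric.ball (0 : EuclideanSpace ℝ (Fin k)) 2,
        ∫⁻ y in Metric.ball (0 : EuclideanSpace ℝ (Fin s)) 2,
          ENNReal.ofReal (Real.exp (8 * l ^ 2)) := by
        refine setLIntegral_mono' measurableSet_ball fun x hx =>
          setLIntegral_mono' measurableSet_ball fun y hy => ?_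
        rw [lintegral_exp_inner_gaussianNoise]
        refine ENNReal.ofReal_le_ofReal (Real.exp_le_exp.2 ?_)
        rw [mem_ball_zero_iff] at hx hy
        -- Radii two give the exponent `l ^ 2 * 4 * 4 / 2 = 8 * l ^ 2`.
        have h1 : ‖x‖ ^ 2 * ‖y‖ ^ 2 ≤ 2 ^ 2 * 2 ^ 2 := by gcongr
        nlinarith [mul_le_mul_of_nonneg_left h1 (sq_nonneg l)]
    _ = _ := by
        rw [setLIntegral_const, setLIntegral_const, hVk2, hVs2, mul_comm (2 ^ (k + s)) (Real.exp _),
          ENNReal.ofReal_mul (Real.exp_pos _).le, pow_add, ENNReal.ofReal_mul (by positivity)]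
        ring

/-- The second moment of the operator norm of the Gaussian noise. -/
theorem lintegral_sq_opNorm_gaussianNoise_le (hk : 0 < k) :
    ∫⁻ Z, ENNReal.ofReal (opNorm Z ^ 2) ∂(gaussianNoise k s) ≤
      ENNReal.ofReal (332 * ((k : ℝ) + s)) := by
  set n : ℝ := (k : ℝ) + s with hn
  have hn1 : 1 ≤ n := by
    have : (1 : ℝ) ≤ k := by exact_mod_cast hk
    have : (0 : ℝ) ≤ s := s.cast_nonneg
    linarith
  -- With `l = √n` the exponential moment is at most `2 ^ n * exp (8 n) ≤ exp (9 n)`, which the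
  -- factor `exp (-9 n)` cancels. The threshold `w = 18 n` is where `w / 2 = w - 9 n`; beyond it `w
  -- ^ 2 ≤ 8 * exp (w / 2)`, and `x ^ 2 ≤ w ^ 2` as `n ≥ 1`.
  have hpt (x : ℝ) (hx : 0 ≤ x) :
      x ^ 2 ≤ 324 * n + 8 * Real.exp (-(9 * n)) * Real.exp (√n * x) := by
    set w := √n * x with hw
    have hw0 : 0 ≤ w := by positivity
    have hw2 : w ^ 2 = n * x ^ 2 := by rw [hw, mul_pow, Real.sq_sqrt (by linarith)]
    rw [mul_assoc, ← Real.exp_add]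
    rcases le_total w (18 * n) with h | h
    · have : n * x ^ 2 ≤ n * (324 * n) := by nlinarith
      have := le_of_mul_le_mul_left this (by linarith)
      have := Real.exp_pos (-(9 * n) + w)
      linarith
    · have h1 : Real.exp (w / 2) ≤ Real.exp (-(9 * n) + w) := Real.exp_le_exp.2 (by linarith)
      have h2 := Real.quadratic_le_exp_of_nonneg (x := w / 2) (by linarith)
      nlinarith [sq_nonneg x]
  have hexp : ∫⁻ Z, ENNReal.ofReal (Real.exp (√n * opNorm Z)) ∂(gaussianNoise k s) ≤
      ENNReal.ofReal (Real.exp (9 * n)) := by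
    refine (lintegral_exp_opNorm_gaussianNoise_le k s (Real.sqrt_nonneg n)).trans
      (ENNReal.ofReal_le_ofReal ?_)
    have h2 : (2 : ℝ) ≤ Real.exp 1 := by linarith [Real.add_one_le_exp (1 : ℝ)]
    calc (2 : ℝ) ^ (k + s) * Real.exp (8 * √n ^ 2)
        ≤ Real.exp 1 ^ (k + s) * Real.exp (8 * √n ^ 2) := by gcongr
      _ = Real.exp (9 * n) := by
        rw [← Real.exp_nat_mul, ← Real.exp_add, Real.sq_sqrt (by linarith)]
        push_cast
        congr 1
        ring
  calc ∫⁻ Z, ENNReal.ofReal (opNorm Z ^ 2) ∂(gaussianNoise k s)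
      ≤ ∫⁻ Z, (ENNReal.ofReal (324 * n) + ENNReal.ofReal (8 * Real.exp (-(9 * n))) *
          ENNReal.ofReal (Real.exp (√n * opNorm Z))) ∂(gaussianNoise k s) := by
        refine lintegral_mono fun Z => ?_
        rw [← ENNReal.ofReal_mul (by positivity),
          ← ENNReal.ofReal_add (by linarith) (by positivity)]
        exact ENNReal.ofReal_le_ofReal (hpt _ (opNorm_nonneg Z))
    _ = ENNReal.ofReal (324 * n) + ENNReal.ofReal (8 * Real.exp (-(9 * n))) *
        ∫⁻ Z, ENNReal.ofReal (Real.exp (√n * opNorm Z)) ∂(gaussianNoise k s) := by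
        rw [lintegral_add_left measurable_const, lintegral_const, measure_univ, mul_one,
          lintegral_const_mul' _ _ ENNReal.ofReal_ne_top]
    _ ≤ ENNReal.ofReal (324 * n) + ENNReal.ofReal (8 * Real.exp (-(9 * n))) *
        ENNReal.ofReal (Real.exp (9 * n)) := by gcongr
    _ = ENNReal.ofReal (324 * n + 8) := by
        rw [← ENNReal.ofReal_mul (by positivity), mul_assoc, ← Real.exp_add, neg_add_cancel,
          Real.exp_zero, mul_one, ENNReal.ofReal_add (by linarith) (by norm_num)]
    _ ≤ _ := ENNReal.ofReal_le_ofReal (by linarith)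

/-! ### Entrywise second moments of the noise -/

theorem measurePreserving_apply_gaussianNoise (i : Fin k) (j : Fin s) :
    MeasurePreserving (fun Z : Matrix (Fin k) (Fin s) ℝ => Z i j) (gaussianNoise k s)
      (gaussianReal 0 1) := by
  have h1 : MeasurePreserving (Function.eval i) (Measure.pi fun _ : Fin k =>
      Measure.pi fun _ : Fin s => gaussianReal 0 1) (Measure.pi fun _ : Fin s => gaussianReal 0 1) :=
    measurePreserving_eval _ i
  have h2 : MeasurePreserving (Function.eval j) (Measure.pi fun _ : Fin s => gaussianReal 0 1)
      (gaussianReal 0 1) :=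
    measurePreserving_eval (fun _ : Fin s => gaussianReal 0 1) j
  have hm : Measurable fun Z : Matrix (Fin k) (Fin s) ℝ => Z i j :=
    Continuous.measurable (by fun_prop)
  refine ⟨hm, ?_⟩
  rw [gaussianNoise, Measure.map_map hm (measurable_matrix_of k s)]
  exact (h2.comp h1).map_eq

theorem one_le_lintegral_sq_sub_gaussianReal (m : ℝ) :
    1 ≤ ∫⁻ z, ENNReal.ofReal ((m - z) ^ 2) ∂(gaussianReal 0 1) := by
  have hL : MemLp (fun z : ℝ => m - z) 2 (gaussianReal 0 1) :=
    (memLp_const m).sub (memLp_id_gaussianReal 2)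
  have hvar : Var[fun z : ℝ => m - z; gaussianReal 0 1] = 1 := by
    rw [variance_const_sub (by fun_prop), variance_fun_id_gaussianReal]
    simp
  rw [← ofReal_integral_eq_lintegral_ofReal hL.integrable_sq (ae_of_all _ fun z => sq_nonneg _),
    ENNReal.one_le_ofReal, ← hvar]
  exact variance_le_expectation_sq hL.aestronglyMeasurable

theorem continuous_sum_mul : Continuous
    fun p : Matrix (Fin k) (Fin s) ℝ × Matrix (Fin k) (Fin s) ℝ =>
      ∑ i, ∑ j, p.1 i j * p.2 i j := by
  fun_prop

/-- Each entry contributes at least its variance, whatever its centre. Averaging over a Gaussian `M`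
would give `2 * k * s`; the bound for fixed `M` loses only this factor. -/
theorem le_lintegral_sum_sq_sub_gaussianNoise (M : Matrix (Fin k) (Fin s) ℝ) :
    ENNReal.ofReal ((k : ℝ) * s) ≤
      ∫⁻ Z, ENNReal.ofReal (∑ i, ∑ j, (M - Z) i j * (M - Z) i j) ∂(gaussianNoise k s) := by
  have hm (i : Fin k) (j : Fin s) : Measurable fun Z : Matrix (Fin k) (Fin s) ℝ =>
      ENNReal.ofReal ((M i j - Z i j) ^ 2) :=
    (Continuous.measurable (f := fun Z : Matrix (Fin k) (Fin s) ℝ => (M i j - Z i j) ^ 2)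
      (by fun_prop)).ennreal_ofReal
  have h1 (Z : Matrix (Fin k) (Fin s) ℝ) :
      ENNReal.ofReal (∑ i, ∑ j, (M - Z) i j * (M - Z) i j) =
        ∑ i, ∑ j, ENNReal.ofReal ((M i j - Z i j) ^ 2) := by
    simp only [Matrix.sub_apply, ← pow_two]
    rw [ENNReal.ofReal_sum_of_nonneg fun i _ => Finset.sum_nonneg fun j _ => sq_nonneg _]
    exact Finset.sum_congr rfl fun i _ => ENNReal.ofReal_sum_of_nonneg fun j _ => sq_nonneg _
  simp_rw [h1]
  rw [lintegral_finsetSum _ fun i _ => Finset.measurable_sum _ fun j _ => hm i j]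
  simp_rw [lintegral_finsetSum _ fun j _ => hm _ j]
  calc ENNReal.ofReal ((k : ℝ) * s) = ∑ _i : Fin k, ∑ _j : Fin s, (1 : ℝ≥0∞) := by
        rw [ENNReal.ofReal_mul (Nat.cast_nonneg k)]; simp
    _ ≤ _ := by
        refine Finset.sum_le_sum fun i _ => Finset.sum_le_sum fun j _ => ?_
        rw [(measurePreserving_apply_gaussianNoise i j).lintegral_comp
          (f := fun z => ENNReal.ofReal ((M i j - z) ^ 2)) (by fun_prop)]
        exact one_le_lintegral_sq_sub_gaussianReal _

/-! ### Upper and lower bounds on the risk -/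

theorem natCast_add_le_two_mul_max (k s : ℕ) : (k : ℝ) + s ≤ 2 * ((max k s : ℕ) : ℝ) := by
  have h : k + s ≤ 2 * max k s := by omega
  exact_mod_cast h

/-- The worst-case risk of the observation itself. -/
theorem maxRisk_id_le (hk : 0 < k) {τ : (Fin (min k s) → ℝ) → ℝ} (hτ : IsSymmetricGauge τ) :
    maxRisk (gaugeNorm τ) (fun Y : Matrix (Fin k) (Fin s) ℝ => Y) ≤
      ENNReal.ofReal (664 * ((max k s : ℕ) : ℝ) * τ (fun _ => 1) ^ 2) := by
  refine iSup_le fun M => ?_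
  simp only [add_sub_cancel_left]
  calc ∫⁻ Z, ENNReal.ofReal (gaugeNorm τ Z ^ 2) ∂(gaussianNoise k s)
      ≤ ∫⁻ Z, ENNReal.ofReal (opNorm Z ^ 2) * ENNReal.ofReal (τ (fun _ => 1) ^ 2)
          ∂(gaussianNoise k s) := by
        refine lintegral_mono fun Z => ?_
        rw [← ENNReal.ofReal_mul (sq_nonneg _), ← mul_pow]
        exact ENNReal.ofReal_le_ofReal
          (pow_le_pow_left₀ (gaugeNorm_nonneg hτ Z) (gaugeNorm_le_opNorm_mul hτ Z) 2)
    _ = (∫⁻ Z, ENNReal.ofReal (opNorm Z ^ 2) ∂(gaussianNoise k s)) *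
          ENNReal.ofReal (τ (fun _ => 1) ^ 2) := lintegral_mul_const' _ _ ENNReal.ofReal_ne_top
    _ ≤ ENNReal.ofReal (332 * ((k : ℝ) + s)) * ENNReal.ofReal (τ (fun _ => 1) ^ 2) := by
        gcongr
        exact lintegral_sq_opNorm_gaussianNoise_le hk
    _ = ENNReal.ofReal (332 * ((k : ℝ) + s) * τ (fun _ => 1) ^ 2) :=
        (ENNReal.ofReal_mul (by positivity)).symm
    _ ≤ _ := by
        refine ENNReal.ofReal_le_ofReal (mul_le_mul_of_nonneg_right ?_ (sq_nonneg _))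
        linarith [natCast_add_le_two_mul_max k s]

/-- From `(a + b)² ≤ 2a² + 2b²`; the constant is `4 * 332 * 2`, the last factor from `k + s ≤ 2 *
max k s`. -/
theorem lintegral_sq_opNorm_sub_le (hk : 0 < k) :
    ∫⁻ M, ∫⁻ Z, ENNReal.ofReal (opNorm (M - Z) ^ 2) ∂(gaussianNoise k s) ∂(gaussianNoise k s) ≤
      ENNReal.ofReal (2656 * ((max k s : ℕ) : ℝ)) := by
  have hm : Measurable fun Z : Matrix (Fin k) (Fin s) ℝ => 2 * ENNReal.ofReal (opNorm Z ^ 2) :=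
    ((continuous_opNorm.pow 2).measurable.ennreal_ofReal).const_mul 2
  have hb := lintegral_sq_opNorm_gaussianNoise_le (s := s) hk
  calc _ ≤ ∫⁻ M, ∫⁻ Z, (2 * ENNReal.ofReal (opNorm M ^ 2) + 2 * ENNReal.ofReal (opNorm Z ^ 2))
          ∂(gaussianNoise k s) ∂(gaussianNoise k s) := by
        refine lintegral_mono fun M => lintegral_mono fun Z => ?_
        rw [← ENNReal.ofReal_ofNat 2, ← ENNReal.ofReal_mul (by norm_num),
          ← ENNReal.ofReal_mul (by norm_num), ← ENNReal.ofReal_add (by positivity) (by positivity)]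
        refine ENNReal.ofReal_le_ofReal ?_
        have := pow_le_pow_left₀ (opNorm_nonneg (M - Z)) (opNorm_sub_le M Z) 2
        nlinarith [sq_nonneg (opNorm M - opNorm Z)]
    _ = 4 * ∫⁻ Z, ENNReal.ofReal (opNorm Z ^ 2) ∂(gaussianNoise k s) := by
        simp_rw [lintegral_add_left measurable_const, lintegral_const, measure_univ, mul_one]
        rw [lintegral_add_left hm, lintegral_const, measure_univ, mul_one,
          lintegral_const_mul' _ _ (by simp), ← add_mul]
        norm_num
    _ ≤ 4 * ENNReal.ofReal (332 * ((k : ℝ) + s)) := by gcongr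
    _ ≤ _ := by
        rw [← ENNReal.ofReal_ofNat 4, ← ENNReal.ofReal_mul (by norm_num)]
        refine ENNReal.ofReal_le_ofReal ?_
        linarith [natCast_add_le_two_mul_max k s]

/-- When the parameter is drawn from the law of the noise, the two are exchangeable given the
observation, so that no estimator can have errors uncorrelated with their difference. -/
theorem le_two_mul_lintegral_abs_sum_mul {est : Matrix (Fin k) (Fin s) ℝ → Matrix (Fin k) (Fin s) ℝ}
    (hest : Measurable est) :
    ENNReal.ofReal ((k : ℝ) * s) ≤ 2 * ∫⁻ M, ∫⁻ Z,
      ENNReal.ofReal |∑ i, ∑ j, (est (M + Z) - M) i j * (M - Z) i j|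
        ∂(gaussianNoise k s) ∂(gaussianNoise k s) := by
  set g : Matrix (Fin k) (Fin s) ℝ → Matrix (Fin k) (Fin s) ℝ → ℝ≥0∞ := fun M Z =>
    ENNReal.ofReal |∑ i, ∑ j, (est (M + Z) - M) i j * (M - Z) i j| with hg
  have hgm : Measurable (Function.uncurry g) := by
    have h1 : Measurable fun p : Matrix (Fin k) (Fin s) ℝ × Matrix (Fin k) (Fin s) ℝ =>
        est (p.1 + p.2) - p.1 :=
      continuous_sub.measurable.comp ((hest.comp continuous_add.measurable).prodMk measurable_fst)
    have h2 : Measurable fun p : Matrix (Fin k) (Fin s) ℝ × Matrix (Fin k) (Fin s) ℝ =>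
        p.1 - p.2 := continuous_sub.measurable
    exact (continuous_abs.measurable.comp
      (continuous_sum_mul.measurable.comp (h1.prodMk h2))).ennreal_ofReal
  have hpt (M Z : Matrix (Fin k) (Fin s) ℝ) :
      ENNReal.ofReal (∑ i, ∑ j, (M - Z) i j * (M - Z) i j) ≤ g M Z + g Z M := by
    rw [hg, ← ENNReal.ofReal_add (abs_nonneg _) (abs_nonneg _)]
    refine ENNReal.ofReal_le_ofReal ?_
    -- Swapping `M` and `Z` leaves the estimate unchanged and flips the sign of `M - Z`, so `est`
    -- cancels from the sum of the two pairings.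
    have h : ∑ i, ∑ j, (M - Z) i j * (M - Z) i j =
        -(∑ i, ∑ j, (est (M + Z) - M) i j * (M - Z) i j) -
          ∑ i, ∑ j, (est (Z + M) - Z) i j * (Z - M) i j := by
      rw [← Finset.sum_neg_distrib, ← Finset.sum_sub_distrib]
      refine Finset.sum_congr rfl fun i _ => ?_
      rw [← Finset.sum_neg_distrib, ← Finset.sum_sub_distrib]
      refine Finset.sum_congr rfl fun j _ => ?_
      rw [add_comm Z M]
      simp only [Matrix.sub_apply]
      ring
    rw [h]
    linarith [neg_abs_le (∑ i, ∑ j, (est (M + Z) - M) i j * (M - Z) i j),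
      neg_abs_le (∑ i, ∑ j, (est (Z + M) - Z) i j * (Z - M) i j)]
  have hswap : ∫⁻ M, ∫⁻ Z, g Z M ∂(gaussianNoise k s) ∂(gaussianNoise k s) =
      ∫⁻ M, ∫⁻ Z, g M Z ∂(gaussianNoise k s) ∂(gaussianNoise k s) :=
    (lintegral_lintegral_swap hgm.aemeasurable).symm
  have hgi : Measurable fun M => ∫⁻ Z, g M Z ∂(gaussianNoise k s) := hgm.lintegral_prod_right'
  calc ENNReal.ofReal ((k : ℝ) * s) = ∫⁻ _, ENNReal.ofReal ((k : ℝ) * s) ∂(gaussianNoise k s) := by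
        simp
    _ ≤ ∫⁻ M, ∫⁻ Z, (g M Z + g Z M) ∂(gaussianNoise k s) ∂(gaussianNoise k s) :=
        lintegral_mono fun M => (le_lintegral_sum_sq_sub_gaussianNoise M).trans
          (lintegral_mono fun Z => hpt M Z)
    _ = ∫⁻ M, ((∫⁻ Z, g M Z ∂(gaussianNoise k s)) + ∫⁻ Z, g Z M ∂(gaussianNoise k s))
          ∂(gaussianNoise k s) :=
        lintegral_congr fun M => lintegral_add_left (hgm.comp measurable_prodMk_left) _
    _ = _ := by
        rw [lintegral_add_left hgi, hswap, two_mul]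

/-- The lower bound on the worst-case risk of every estimator. -/
theorem le_maxRisk (hk : 0 < k) (hs : 0 < s) {τ : (Fin (min k s) → ℝ) → ℝ}
    (hτ : IsSymmetricGauge τ) {est : Matrix (Fin k) (Fin s) ℝ → Matrix (Fin k) (Fin s) ℝ}
    (hest : Measurable est) :
    ENNReal.ofReal (1 / 10624 * ((max k s : ℕ) : ℝ) * τ (fun _ => 1) ^ 2) ≤
      maxRisk (gaugeNorm τ) est := by
  set D : ℝ := ((max k s : ℕ) : ℝ) with hD
  set d : ℝ := ((min k s : ℕ) : ℝ) with hd
  set t : ℝ := τ fun _ => 1 with ht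
  have ht0 : 0 ≤ t := hτ.nonneg _
  have hd0 : 0 < d := by
    rw [hd]
    exact_mod_cast lt_min hk hs
  have hkd : (k : ℝ) * s = d * D := by
    rw [hd, hD]
    exact_mod_cast (min_mul_max k s).symm
  -- The weight in `2 * a * x * b ≤ x² + a² * b²`, used in place of Cauchy–Schwarz. The final bound
  -- is `a * t * D - 2656 * a² * D`, maximal at `a = t / (2 * 2656)` with value `t² * D / 10624`.
  set a : ℝ := t / 5312 with ha
  have ha0 : 0 ≤ a := by positivity
  have hpt (M Z : Matrix (Fin k) (Fin s) ℝ) :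
      ENNReal.ofReal (2 * a * (t / d)) *
          ENNReal.ofReal |∑ i, ∑ j, (est (M + Z) - M) i j * (M - Z) i j| ≤
        ENNReal.ofReal (gaugeNorm τ (est (M + Z) - M) ^ 2) +
          ENNReal.ofReal (a ^ 2) * ENNReal.ofReal (opNorm (M - Z) ^ 2) := by
    rw [← ENNReal.ofReal_mul (by positivity), ← ENNReal.ofReal_mul (by positivity),
      ← ENNReal.ofReal_add (by positivity) (by positivity)]
    refine ENNReal.ofReal_le_ofReal ?_
    have h1 := abs_sum_mul_mul_le_gaugeNorm hτ (est (M + Z) - M) (M - Z)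
    set x := gaugeNorm τ (est (M + Z) - M)
    set b := opNorm (M - Z)
    have h2 : t / d * |∑ i, ∑ j, (est (M + Z) - M) i j * (M - Z) i j| ≤ x * b := by
      rw [div_mul_eq_mul_div, div_le_iff₀ hd0]
      linarith
    nlinarith [mul_le_mul_of_nonneg_left h2 ha0, sq_nonneg (x - a * b)]
  have hM (M : Matrix (Fin k) (Fin s) ℝ) :
      ENNReal.ofReal (2 * a * (t / d)) *
          ∫⁻ Z, ENNReal.ofReal |∑ i, ∑ j, (est (M + Z) - M) i j * (M - Z) i j|
            ∂(gaussianNoise k s) ≤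
        maxRisk (gaugeNorm τ) est + ENNReal.ofReal (a ^ 2) *
          ∫⁻ Z, ENNReal.ofReal (opNorm (M - Z) ^ 2) ∂(gaussianNoise k s) := by
    have hb : Measurable fun Z : Matrix (Fin k) (Fin s) ℝ =>
        ENNReal.ofReal (a ^ 2) * ENNReal.ofReal (opNorm (M - Z) ^ 2) :=
      (((continuous_opNorm.comp (continuous_sub_left M)).pow
        2).measurable.ennreal_ofReal).const_mul _
    rw [← lintegral_const_mul' _ _ ENNReal.ofReal_ne_top,
      ← lintegral_const_mul' _ _ ENNReal.ofReal_ne_top]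
    refine (lintegral_mono fun Z => hpt M Z).trans ?_
    rw [lintegral_add_right _ hb]
    gcongr
    exact le_iSup (fun M => ∫⁻ Z, ENNReal.ofReal (gaugeNorm τ (est (M + Z) - M) ^ 2)
      ∂(gaussianNoise k s)) M
  -- Averaging over the Gaussian prior on `M`; the worst-case risk is constant in `M`.
  have hint := lintegral_mono (μ := gaussianNoise k s) hM
  rw [lintegral_const_mul' _ _ ENNReal.ofReal_ne_top, lintegral_add_left measurable_const,
    lintegral_const, measure_univ, mul_one, lintegral_const_mul' _ _ ENNReal.ofReal_ne_top] at hint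
  have hmain : ENNReal.ofReal (a * (t / d) * (d * D)) ≤
      maxRisk (gaugeNorm τ) est + ENNReal.ofReal (a ^ 2 * (2656 * D)) := by
    calc ENNReal.ofReal (a * (t / d) * (d * D))
        = ENNReal.ofReal (a * (t / d)) * ENNReal.ofReal ((k : ℝ) * s) := by
          rw [hkd, ENNReal.ofReal_mul (by positivity)]
      _ ≤ ENNReal.ofReal (a * (t / d)) * (2 * ∫⁻ M, ∫⁻ Z,
            ENNReal.ofReal |∑ i, ∑ j, (est (M + Z) - M) i j * (M - Z) i j|
              ∂(gaussianNoise k s) ∂(gaussianNoise k s)) := by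
          gcongr
          exact le_two_mul_lintegral_abs_sum_mul hest
      _ = ENNReal.ofReal (2 * a * (t / d)) * ∫⁻ M, ∫⁻ Z,
            ENNReal.ofReal |∑ i, ∑ j, (est (M + Z) - M) i j * (M - Z) i j|
              ∂(gaussianNoise k s) ∂(gaussianNoise k s) := by
          rw [mul_assoc 2 a, ENNReal.ofReal_mul (p := 2) (by norm_num), ENNReal.ofReal_ofNat]
          ring
      _ ≤ _ := hint
      _ ≤ _ := by
          rw [ENNReal.ofReal_mul (sq_nonneg a)]
          gcongr
          exact lintegral_sq_opNorm_sub_le hk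
  rw [← tsub_le_iff_right, ← ENNReal.ofReal_sub _ (by positivity)] at hmain
  refine le_trans (ENNReal.ofReal_le_ofReal (le_of_eq ?_)) hmain
  rw [ha]
  field_simp
  ring

end MatrixMinimax

theorem theorem3p2 :
    -- every unitarily invariant norm is of the form `‖·‖_τ` for a symmetric gauge function `τ`
    (∀ (k s : ℕ), 0 < k → 0 < s → ∀ N : Matrix (Fin k) (Fin s) ℝ → ℝ,
      MatrixMinimax.IsUnitarilyInvariantNorm N →
        ∃ τ : (Fin (min k s) → ℝ) → ℝ, MatrixMinimax.IsSymmetricGauge τ ∧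
          ∀ A, N A = MatrixMinimax.gaugeNorm τ A) ∧
    -- the minimax rate, with absolute constants, attained by the observation itself
    ∃ c C : ℝ, 0 < c ∧ 0 < C ∧
      ∀ (k s : ℕ), 0 < k → 0 < s →
      ∀ τ : (Fin (min k s) → ℝ) → ℝ, MatrixMinimax.IsSymmetricGauge τ →
        ENNReal.ofReal (c * ((max k s : ℕ) : ℝ) * τ (fun _ => 1) ^ 2)
            ≤ MatrixMinimax.minimaxRisk (k := k) (s := s) (MatrixMinimax.gaugeNorm τ) ∧
        MatrixMinimax.minimaxRisk (k := k) (s := s) (MatrixMinimax.gaugeNorm τ)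
            ≤ ENNReal.ofReal (C * ((max k s : ℕ) : ℝ) * τ (fun _ => 1) ^ 2) ∧
        MatrixMinimax.maxRisk (k := k) (s := s) (MatrixMinimax.gaugeNorm τ) (fun Y => Y)
            ≤ ENNReal.ofReal (C * ((max k s : ℕ) : ℝ) * τ (fun _ => 1) ^ 2) := by
  refine ⟨fun k s _ _ N hN => hN.exists_eq_gaugeNorm, 1 / 10624, 664, by norm_num, by norm_num,
    fun k s hk hs τ hτ => ⟨?_, ?_, MatrixMinimax.maxRisk_id_le hk hτ⟩⟩
  · exact le_iInf₂ fun est hest => MatrixMinimax.le_maxRisk hk hs hτ hest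
  · exact (iInf₂_le _ measurable_id).trans (MatrixMinimax.maxRisk_id_le hk hτ)
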